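/- Let $H$ be a complex Hilbert space, let $N\subset \mathscr L(H)$ be a (semi-finite) von Neumann algebra and let $\tau\colon N_+\to[0,\infty]$ be a normal, faithful, semi-finite trace. Let \[ \mathscr L^1_\tau(N)=\{x\in N:\tau(|x|)<\infty\},\qquad \|x\|_{1,\infty}=\|x\|+\tau(|x|), \] where $\|\cdot\|$ is the operator norm; this is a Banach algebra. For a (possibly non-unital) complex Banach algebra $A$ with unitization $A^+$, and $n\in\mathbb N$, put $\mathrm{GL}_n(A)=\{g\in \mathrm{GL}_n(A^+): g-1_n\in M_n(A)\}$, and let $\mathrm{GL}_\infty(A)=\varinjlim_n \mathrm{GL}_n(A)$ be the direct limit under the inclusions $g\mapsto g\oplus 1_{m-n}$ $(n\le m)$, equipped with the metric $d(x,y)=\sum_{i,j\ge1}\|x_{ij}-y_{ij}\|_A$, which makes it a topological group. Let $\mathrm{GL}^0_\infty(A)$ be the path component of the identity and $K_1^{\mathrm{top}}(A)=\mathrm{GL}_\infty(A)/\mathrm{GL}^0_\infty(A)$. Then the first topological $K$-group of the Banach algebra $(\mathscr L^1_\tau(N),\|\cdot\|_{1,\infty})$ is trivial: \[ K_1^{\mathrm{top}}(\mathscr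 L^1_\tau(N))=\{0\}. \] -/

import Mathlib

open scoped ENNReal NNReal

noncomputable section

namespace TopologicalK

/-- The block sum `g ⊕ 1_{m-n}`. -/
def stabilize {R : Type*} [Semiring R] {n m : ℕ} (h : n ≤ m) :
    Matrix (Fin n) (Fin n) R →* Matrix (Fin m) (Fin m) R where
  toFun g := Matrix.of fun i j =>
    if hij : i.1 < n ∧ j.1 < n then g ⟨i.1, hij.1⟩ ⟨j.1, hij.2⟩ else if i = j then 1 else 0
  map_one' := by
    ext i j
    by_cases hij : i.1 < n ∧ j.1 < n <;> simp [Matrix.one_apply, Fin.ext_iff]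
  map_mul' g k := by
    obtain ⟨d, rfl⟩ := Nat.exists_eq_add_of_le h
    ext i j
    rw [Matrix.mul_apply, Fin.sum_univ_add]
    have h1 : ∀ (x : Fin n) (y : Fin d), (x : ℕ) ≠ n + y := fun x y => by have := x.2; omega
    have h2 : ∀ (x : Fin n) (y : Fin d), n + (y : ℕ) ≠ x := fun x y => (h1 x y).symm
    refine Fin.addCases (fun i => ?_) (fun i => ?_) i <;>
      refine Fin.addCases (fun j => ?_) (fun j => ?_) j <;>
      simp [Matrix.mul_apply, Fin.ext_iff, h1, h2]
    simp [← Fin.ext_iff]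

theorem stabilize_apply {R : Type*} [Semiring R] {n m : ℕ} (h : n ≤ m)
    (g : Matrix (Fin n) (Fin n) R) (i j : Fin m) :
    stabilize h g i j =
      if hij : i.1 < n ∧ j.1 < n then g ⟨i.1, hij.1⟩ ⟨j.1, hij.2⟩ else if i = j then 1 else 0 :=
  rfl

theorem snd_sub {A : Type*} [NonUnitalNormedRing A] (x y : Unitization ℂ A) :
    (x - y).snd = x.snd - y.snd :=
  rfl

theorem sum_norm_add_le {A : Type*} [NonUnitalNormedRing A] {n : ℕ}
    (a b : Matrix (Fin n) (Fin n) A) :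
    ∑ i, ∑ j, ‖(a + b) i j‖ ≤ (∑ i, ∑ j, ‖a i j‖) + ∑ i, ∑ j, ‖b i j‖ := by
  simp only [← Finset.sum_add_distrib]
  exact Finset.sum_le_sum fun i _ => Finset.sum_le_sum fun j _ => norm_add_le _ _

theorem sum_norm_mul_le {A : Type*} [NonUnitalNormedRing A] {n : ℕ}
    (a b : Matrix (Fin n) (Fin n) A) :
    ∑ i, ∑ j, ‖(a * b) i j‖ ≤ (∑ i, ∑ j, ‖a i j‖) * ∑ i, ∑ j, ‖b i j‖ := by
  calc ∑ i, ∑ j, ‖(a * b) i j‖ ≤ ∑ i, ∑ j, ∑ k, ‖a i k‖ * ‖b k j‖ := by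
        refine Finset.sum_le_sum fun i _ => Finset.sum_le_sum fun j _ => ?_
        rw [Matrix.mul_apply]
        exact (norm_sum_le _ _).trans (Finset.sum_le_sum fun k _ => norm_mul_le _ _)
    _ = ∑ i, ∑ k, ‖a i k‖ * ∑ j, ‖b k j‖ := by
        refine Finset.sum_congr rfl fun i _ => ?_
        rw [Finset.sum_comm]
        simp only [Finset.mul_sum]
    _ ≤ ∑ i, ∑ k, ‖a i k‖ * ∑ l, ∑ j, ‖b l j‖ := by
        refine Finset.sum_le_sum fun i _ => Finset.sum_le_sum fun k _ => ?_
        refine mul_le_mul_of_nonneg_left ?_ (norm_nonneg _)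
        exact Finset.single_le_sum (f := fun l => ∑ j, ‖b l j‖)
          (fun l _ => Finset.sum_nonneg fun j _ => norm_nonneg _) (Finset.mem_univ k)
    _ = _ := by simp only [Finset.sum_mul]

section Banach

variable (A : Type*) [NonUnitalNormedRing A] [NormedSpace ℂ A] [IsScalarTower ℂ A A]
  [SMulCommClass ℂ A A]

variable {A} in
theorem exists_sub_one_eq_iff {n : ℕ} (g : Matrix (Fin n) (Fin n) (Unitization ℂ A)) :
    (∃ a : Matrix (Fin n) (Fin n) A, g - 1 = a.map Unitization.inr) ↔
      (Unitization.fstHom ℂ A).toRingHom.mapMatrix g = 1 := by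
  constructor
  · rintro ⟨a, ha⟩
    rw [eq_add_of_sub_eq ha, map_add, map_one]
    convert zero_add _
    ext i j
    simp
  · intro h
    refine ⟨g.map fun x => x.snd, ?_⟩
    ext i j
    · have := congr_fun₂ h i j
      by_cases hij : i = j
      · subst hij
        simpa [sub_eq_add_neg, add_neg_eq_zero] using this
      · simpa [hij] using this
    · by_cases hij : i = j
      · subst hij
        change (g i i - (1 : Matrix (Fin n) (Fin n) (Unitization ℂ A)) i i).snd = (g i i).snd
        rw [snd_sub, Matrix.one_apply_eq, Unitization.snd_one, sub_zero]
      · simp [hij]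

/-- `GL_n(A) = {g ∈ GL_n(A⁺) : g - 1 ∈ M_n(A)}`, where `A⁺` is the unitization of `A`.  If `A`
happens to have a unit `e`, then `A⁺ ≅ A × ℂ` via `a + c ↦ (a + c e, c)`, which identifies this
group, together with the distance `‖g - h‖`, with the group of invertible elements of `M_n(A)`. -/
def GLn (n : ℕ) : Subgroup (Matrix (Fin n) (Fin n) (Unitization ℂ A))ˣ where
  carrier := {g | ∃ a : Matrix (Fin n) (Fin n) A,
    (g : Matrix (Fin n) (Fin n) (Unitization ℂ A)) - 1 = a.map Unitization.inr}
  one_mem' := (exists_sub_one_eq_iff _).2 (map_one _)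
  mul_mem' {g k} hg hk := (exists_sub_one_eq_iff _).2 (by
    rw [Units.val_mul, map_mul, (exists_sub_one_eq_iff _).1 hg, (exists_sub_one_eq_iff _).1 hk,
      one_mul])
  inv_mem' {g} hg := (exists_sub_one_eq_iff _).2 (by
    have h := congr_arg (Unitization.fstHom ℂ A).toRingHom.mapMatrix g.mul_inv
    rwa [map_mul, (exists_sub_one_eq_iff _).1 hg, one_mul, map_one] at h)

variable {A} in
/-- The matrix `g - 1 ∈ M_n(A)` for `g ∈ GL_n(A)`. -/
def subOne {n : ℕ} (g : GLn A n) : Matrix (Fin n) (Fin n) A :=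
  ((g.1 : Matrix (Fin n) (Fin n) (Unitization ℂ A)) - 1).map fun x => x.snd

theorem GLn.coe_eq {n : ℕ} (g : GLn A n) :
    (g.1 : Matrix (Fin n) (Fin n) (Unitization ℂ A)) = 1 + (subOne g).map Unitization.inr := by
  obtain ⟨a, ha⟩ := g.2
  have : subOne g = a := by
    rw [subOne, ha]
    ext i j
    simp
  rw [this, ← ha, add_sub_cancel]

theorem subOne_mul {n : ℕ} (g k : GLn A n) :
    subOne (g * k) = subOne g + subOne k + subOne g * subOne k := by
  have e : (subOne g + subOne k + subOne g * subOne k).map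
      (Unitization.inr : A → Unitization ℂ A) = (subOne g).map Unitization.inr +
        (subOne k).map Unitization.inr + (subOne g).map Unitization.inr *
          (subOne k).map Unitization.inr := by
    ext1 i j
    simp only [Matrix.map_apply, Matrix.add_apply, Matrix.mul_apply, Unitization.inr_add,
      ← Unitization.inr_mul]
    exact congr_arg _ (map_sum (Unitization.inrNonUnitalAlgHom ℂ A) _ _)
  have h : (subOne (g * k)).map (Unitization.inr : A → Unitization ℂ A) =
      (subOne g + subOne k + subOne g * subOne k).map Unitization.inr := by
    have h1 := GLn.coe_eq A (g * k)
    rw [Subgroup.coe_mul, Units.val_mul, GLn.coe_eq A g, GLn.coe_eq A k] at h1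
    rw [e, ← sub_eq_iff_eq_add'.2 h1]
    noncomm_ring
  exact Matrix.map_injective Unitization.inr_injective h

theorem subOne_injective {n : ℕ} : Function.Injective (subOne : GLn A n → Matrix (Fin n) (Fin n) A) := by
  intro g k h
  exact Subtype.ext (Units.ext (by rw [GLn.coe_eq, GLn.coe_eq, h]))

/-- The inclusion `GL_n(A) → GL_m(A)`, `g ↦ g ⊕ 1_{m-n}`, for `n ≤ m`. -/
def GLn.incl (n m : ℕ) (h : n ≤ m) : GLn A n →* GLn A m :=
  ((Units.map (stabilize h)).comp (GLn A n).subtype).codRestrict (GLn A m) (by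
    rintro ⟨g, a, ha⟩
    refine ⟨Matrix.of fun i j =>
      if hij : i.1 < n ∧ j.1 < n then a ⟨i.1, hij.1⟩ ⟨j.1, hij.2⟩ else 0, ?_⟩
    ext1 i j
    by_cases hij : i.1 < n ∧ j.1 < n
    · have := congr_fun₂ ha ⟨i.1, hij.1⟩ ⟨j.1, hij.2⟩
      simpa [stabilize_apply, hij, Matrix.one_apply, Fin.ext_iff] using this
    · by_cases h' : i = j
      · subst h'
        simp [stabilize_apply, show ¬ i.1 < n by simpa using hij]
      · rw [Matrix.map_apply, Matrix.of_apply, dif_neg hij]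
        simp [stabilize_apply, h', dif_neg hij])

@[simp]
theorem GLn.coe_incl (n m : ℕ) (h : n ≤ m) (g : GLn A n) :
    ((GLn.incl A n m h g).1 : Matrix (Fin m) (Fin m) (Unitization ℂ A)) = stabilize h g.1.1 :=
  rfl

instance : DirectedSystem (fun n => GLn A n) (fun _ _ h => GLn.incl A _ _ h) where
  map_self n g := by
    refine Subtype.ext (Units.ext ?_)
    ext1 i j
    simp [stabilize_apply]
  map_map k j i hij hjk g := by
    refine Subtype.ext (Units.ext ?_)
    ext1 a b
    simp only [GLn.coe_incl, stabilize_apply]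
    split_ifs <;> simp_all [Fin.ext_iff] <;> omega

/-- `GL_∞(A)`, the direct limit of the groups `GL_n(A)`. -/
def GLInf : Type _ := DirectLimit (fun n => GLn A n) (GLn.incl A)

instance : Group (GLInf A) :=
  inferInstanceAs (Group (DirectLimit (fun n => GLn A n) (GLn.incl A)))

namespace GLInf

variable {A}

/-- The class in `GL_∞(A)` of an element of `GL_n(A)`. -/
def mk (n : ℕ) (g : GLn A n) : GLInf A :=
  (⟦⟨n, g⟩⟧ : DirectLimit (fun n => GLn A n) (GLn.incl A))

theorem mk_one (n : ℕ) : mk n (1 : GLn A n) = 1 :=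
  (DirectLimit.one_def (G := fun n => GLn A n) (f := GLn.incl A) n).symm

theorem mk_mul (n : ℕ) (g k : GLn A n) : mk n (g * k) = mk n g * mk n k :=
  (DirectLimit.mul_def (G := fun n => GLn A n) (f := GLn.incl A) n g k).symm

theorem mk_incl {n m : ℕ} (h : n ≤ m) (g : GLn A n) : mk m (GLn.incl A n m h g) = mk n g :=
  DirectLimit.mk_apply (F := fun n => GLn A n) (f := GLn.incl A) n m g h

theorem exists_eq_mk (x : GLInf A) : ∃ n g, x = mk n g :=
  DirectLimit.exists_eq_mk (F := fun n => GLn A n) (GLn.incl A) x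

theorem exists_eq_mk₂ (x y : GLInf A) : ∃ n g k, x = mk n g ∧ y = mk n k :=
  DirectLimit.exists_eq_mk₂ (F := fun n => GLn A n) (GLn.incl A) x y

theorem exists_eq_mk₃ (x y z : GLInf A) : ∃ n g k l, x = mk n g ∧ y = mk n k ∧ z = mk n l :=
  DirectLimit.exists_eq_mk₃ (F := fun n => GLn A n) (GLn.incl A) x y z

/-- The entry of `x - 1 ∈ M_∞(A)` at position `(i, j)`: for `x` represented by `g ∈ GL_n(A)`, it
is the entry of `g - 1 ∈ M_n(A)` if `i, j < n`, and `0` otherwise. -/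
def coeff (x : GLInf A) (i j : ℕ) : A :=
  DirectLimit.lift (F := fun n => GLn A n) (GLn.incl A)
    (fun n g => if h : i < n ∧ j < n then
      subOne g ⟨i, h.1⟩ ⟨j, h.2⟩ else 0)
    (fun n m hnm g => by
      by_cases h : i < n ∧ j < n
      · have h' : i < m ∧ j < m := by omega
        simp [subOne, stabilize_apply, h, h', Matrix.one_apply]
      · by_cases h' : i < m ∧ j < m
        · rw [dif_neg h, dif_pos h', subOne, GLn.coe_incl, Matrix.map_apply, Matrix.sub_apply, stabilize_apply, dif_neg h,
            Matrix.one_apply, sub_self, Unitization.snd_zero]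
        · simp [h, h'])
    x

theorem coeff_mk {n : ℕ} (g : GLn A n) (i j : ℕ) : coeff (mk n g) i j =
    if h : i < n ∧ j < n then subOne g ⟨i, h.1⟩ ⟨j, h.2⟩ else 0 :=
  rfl

/-- `d(x, y) = ‖x - y‖_{M_∞(A)} = ∑_{i,j} ‖x_{ij} - y_{ij}‖`. -/
instance : Dist (GLInf A) :=
  ⟨fun x y => ∑' p : ℕ × ℕ, ‖coeff x p.1 p.2 - coeff y p.1 p.2‖⟩

theorem dist_def (x y : GLInf A) :
    dist x y = ∑' p : ℕ × ℕ, ‖coeff x p.1 p.2 - coeff y p.1 p.2‖ :=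
  rfl

theorem dist_mk {n : ℕ} (g k : GLn A n) :
    dist (mk n g) (mk n k) = ∑ i, ∑ j, ‖(subOne g - subOne k) i j‖ := by
  rw [dist_def, tsum_eq_sum (s := Finset.range n ×ˢ Finset.range n), Finset.sum_product,
    Finset.sum_range]
  · refine Finset.sum_congr rfl fun i _ => ?_
    rw [Finset.sum_range]
    refine Finset.sum_congr rfl fun j _ => ?_
    simp [coeff_mk]
  · rintro ⟨i, j⟩ h
    have h' : ¬ (i < n ∧ j < n) := by simpa using h
    simp [coeff_mk, h']

instance : MetricSpace (GLInf A) where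
  dist_self x := by simp [dist_def]
  dist_comm x y := by simp only [dist_def, norm_sub_rev]
  dist_triangle x y z := by
    obtain ⟨n, g, k, l, rfl, rfl, rfl⟩ := exists_eq_mk₃ x y z
    simp only [dist_mk, ← Finset.sum_add_distrib]
    refine Finset.sum_le_sum fun i _ => Finset.sum_le_sum fun j _ => ?_
    simpa only [Matrix.sub_apply] using norm_sub_le_norm_sub_add_norm_sub _ _ _
  eq_of_dist_eq_zero {x y} h := by
    obtain ⟨n, g, k, rfl, rfl⟩ := exists_eq_mk₂ x y
    rw [dist_mk] at h
    congr 1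
    refine subOne_injective A ?_
    ext i j
    have h1 := (Finset.sum_eq_zero_iff_of_nonneg
      (fun i _ => Finset.sum_nonneg fun j _ => norm_nonneg _)).1 h i (Finset.mem_univ i)
    have h2 := (Finset.sum_eq_zero_iff_of_nonneg (fun j _ => norm_nonneg _)).1 h1 j
      (Finset.mem_univ j)
    exact sub_eq_zero.1 (norm_eq_zero.1 h2)

theorem dist_mul_right_le (x y z : GLInf A) :
    dist (x * z) (y * z) ≤ dist x y * (1 + dist z 1) := by
  obtain ⟨n, g, k, l, rfl, rfl, rfl⟩ := exists_eq_mk₃ x y z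
  have h1 : subOne (1 : GLn A n) = 0 := by ext i j; simp [subOne]
  rw [← mk_mul, ← mk_mul, ← mk_one n, dist_mk, dist_mk, dist_mk, h1, sub_zero, mul_add, mul_one]
  have : subOne (g * l) - subOne (k * l) =
      (subOne g - subOne k) + (subOne g - subOne k) * subOne l := by
    rw [subOne_mul, subOne_mul, Matrix.sub_mul]
    abel
  rw [this]
  exact (sum_norm_add_le _ _).trans (by gcongr; exact sum_norm_mul_le _ _)

theorem dist_mul_left_le (x y z : GLInf A) :
    dist (z * x) (z * y) ≤ (1 + dist z 1) * dist x y := by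
  obtain ⟨n, g, k, l, rfl, rfl, rfl⟩ := exists_eq_mk₃ x y z
  have h1 : subOne (1 : GLn A n) = 0 := by ext i j; simp [subOne]
  rw [← mk_mul, ← mk_mul, ← mk_one n, dist_mk, dist_mk, dist_mk, h1, sub_zero, add_mul, one_mul]
  have : subOne (l * g) - subOne (l * k) =
      (subOne g - subOne k) + subOne l * (subOne g - subOne k) := by
    rw [subOne_mul, subOne_mul, Matrix.mul_sub]
    abel
  rw [this]
  exact (sum_norm_add_le _ _).trans (by gcongr; exact sum_norm_mul_le _ _)

instance : IsTopologicalGroup (GLInf A) where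
  continuous_mul := by
    rw [continuous_iff_continuousAt]
    rintro ⟨x, y⟩
    rw [ContinuousAt, tendsto_iff_dist_tendsto_zero]
    refine squeeze_zero (g := fun p : GLInf A × GLInf A =>
      dist p.1 x * (1 + dist p.2 1) + (1 + dist x 1) * dist p.2 y) (fun _ => dist_nonneg)
      (fun p => (dist_triangle _ (x * p.2) _).trans
        (add_le_add (dist_mul_right_le _ _ _) (dist_mul_left_le _ _ _))) ?_
    have : Continuous fun p : GLInf A × GLInf A =>
      dist p.1 x * (1 + dist p.2 1) + (1 + dist x 1) * dist p.2 y := by fun_prop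
    simpa using this.tendsto (x, y)
  continuous_inv := by
    rw [continuous_iff_continuousAt]
    intro x
    rw [ContinuousAt, tendsto_iff_dist_tendsto_zero]
    set c : ℝ := 1 + dist x⁻¹ 1 with hc
    have hc1 : 1 ≤ c := by linarith [dist_nonneg (x := x⁻¹) (y := 1)]
    have key : ∀ y : GLInf A, dist y x * c ≤ 1 / 2 → dist y⁻¹ x⁻¹ ≤ 2 * c ^ 2 * dist y x := by
      intro y hy
      have h1 : dist y⁻¹ x⁻¹ ≤ (1 + dist y⁻¹ 1) * (dist y x * c) := by
        have e1 : y⁻¹ = y⁻¹ * (x * x⁻¹) := by group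
        have e2 : x⁻¹ = y⁻¹ * (y * x⁻¹) := by group
        calc dist y⁻¹ x⁻¹ = dist (y⁻¹ * (x * x⁻¹)) (y⁻¹ * (y * x⁻¹)) := by rw [← e1, ← e2]
          _ ≤ (1 + dist y⁻¹ 1) * dist (x * x⁻¹) (y * x⁻¹) := dist_mul_left_le _ _ _
          _ ≤ (1 + dist y⁻¹ 1) * (dist y x * c) := by
            gcongr
            rw [dist_comm y x]
            exact dist_mul_right_le _ _ _
      have h2 : dist y⁻¹ 1 ≤ dist y⁻¹ x⁻¹ + dist x⁻¹ 1 := dist_triangle _ _ _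
      have h3 := dist_nonneg (x := y) (y := x)
      have h4 := dist_nonneg (x := y⁻¹) (y := x⁻¹)
      have h5 : dist y⁻¹ x⁻¹ ≤ (c + dist y⁻¹ x⁻¹) * (dist y x * c) :=
        h1.trans (mul_le_mul_of_nonneg_right (by linarith) (by positivity))
      nlinarith
    refine squeeze_zero' (g := fun y => 2 * c ^ 2 * dist y x)
      (Filter.Eventually.of_forall fun _ => dist_nonneg) ?_ ?_
    · have : Continuous fun y : GLInf A => dist y x * c := by fun_prop
      have h := this.tendsto x
      rw [dist_self, zero_mul] at h
      filter_upwards [h.eventually_le_const (by norm_num : (0 : ℝ) < 1 / 2)] with y hy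
      exact key y hy
    · have : Continuous fun y : GLInf A => 2 * c ^ 2 * dist y x := by fun_prop
      simpa using this.tendsto x

end GLInf

/-- `K₁ᵗᵒᵖ(A) = GL_∞(A) / GL_∞⁰(A)`, where `GL_∞⁰(A)` is the path component of the identity. -/
abbrev K₁ : Type _ := GLInf A ⧸ Subgroup.pathComponentOne (GLInf A)

end Banach

end TopologicalK

namespace TraceIdeal

variable {H : Type*} [NormedAddCommGroup H] [InnerProductSpace ℂ H] [CompleteSpace H]

/-- A normal, faithful, semi-finite trace `τ : N₊ → [0, ∞]` on a von Neumann algebra `N`.  Only the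
values of `toFun` on the positive cone `N₊ = {x ∈ N : 0 ≤ x}` are relevant. -/
structure NFSTrace (N : VonNeumannAlgebra H) where
  /-- The underlying function. -/
  toFun : (H →L[ℂ] H) → ℝ≥0∞
  map_add : ∀ x ∈ N, ∀ y ∈ N, 0 ≤ x → 0 ≤ y → toFun (x + y) = toFun x + toFun y
  /-- Homogeneity, with the convention `0 * ∞ = 0`. -/
  map_smul : ∀ r : ℝ≥0, ∀ x ∈ N, 0 ≤ x → toFun (r • x) = r * toFun x
  tracial : ∀ x ∈ N, toFun (star x * x) = toFun (x * star x)
  faithful : ∀ x ∈ N, 0 ≤ x → toFun x = 0 → x = 0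
  /-- `τ` is compatible with suprema of increasing families. -/
  normal : ∀ (S : Set (H →L[ℂ] H)) (x : H →L[ℂ] H), S.Nonempty → DirectedOn (· ≤ ·) S →
    (∀ y ∈ S, y ∈ N ∧ 0 ≤ y) → x ∈ N → IsLUB S x → IsLUB (toFun '' S) (toFun x)
  /-- `τ x` is the supremum of the finite values of `τ` on elements of `N₊` below `x`. -/
  semifinite : ∀ x ∈ N, 0 ≤ x → IsLUB (toFun '' {y | y ∈ N ∧ 0 ≤ y ∧ y ≤ x ∧ toFun y < ∞}) (toFun x)

theorem mem_of_commute {N : VonNeumannAlgebra H} {x : H →L[ℂ] H}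
    (h : ∀ g ∈ N.commutant, Commute g x) : x ∈ N := by
  rw [← N.commutant_commutant, VonNeumannAlgebra.mem_commutant_iff]
  exact fun g hg => h g hg

theorem commute_of_mem {N : VonNeumannAlgebra H} {x g : H →L[ℂ] H} (hx : x ∈ N)
    (hg : g ∈ N.commutant) : Commute x g :=
  VonNeumannAlgebra.mem_commutant_iff.1 hg x hx

theorem abs_mem {N : VonNeumannAlgebra H} {x : H →L[ℂ] H} (hx : x ∈ N) : CFC.abs x ∈ N :=
  mem_of_commute fun _ hg => ((commute_of_mem hx hg).cfcAbs_left
    (commute_of_mem hx (star_mem hg))).symm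

theorem sqrt_mem {N : VonNeumannAlgebra H} {x : H →L[ℂ] H} (hx : x ∈ N) : CFC.sqrt x ∈ N :=
  mem_of_commute fun _ hg => (Commute.cfcₙ_nnreal (commute_of_mem hx hg) _).symm

theorem smul_mem {N : VonNeumannAlgebra H} {x : H →L[ℂ] H} (c : ℂ) (hx : x ∈ N) : c • x ∈ N :=
  N.toStarSubalgebra.smul_mem hx c

/-- Polar decomposition. -/
theorem exists_polar {N : VonNeumannAlgebra H} {x : H →L[ℂ] H} (hx : x ∈ N) :
    ∃ v ∈ N, ‖v‖ ≤ 1 ∧ x = v * CFC.abs x ∧ CFC.abs x = star v * x := by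
  set a := CFC.abs x with ha
  have hsa : star a = a := (CFC.abs_nonneg x).isSelfAdjoint.star_eq
  have haa : a * a = star x * x := CFC.abs_mul_abs x
  have hnorm : ∀ ξ, ‖x ξ‖ = ‖a ξ‖ := by
    intro ξ
    have h1 : inner ℂ (x ξ) (x ξ) = inner ℂ (a ξ) (a ξ) := by
      rw [← ContinuousLinearMap.adjoint_inner_right, ← ContinuousLinearMap.adjoint_inner_right a]
      have := congr_arg (fun T : H →L[ℂ] H => inner ℂ ξ (T ξ)) haa
      rw [← hsa] at this
      nth_rewrite 2 [hsa] at this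
      exact this.symm
    rw [inner_self_eq_norm_sq_to_K, inner_self_eq_norm_sq_to_K] at h1
    have h2 : ‖x ξ‖ ^ 2 = ‖a ξ‖ ^ 2 := by exact_mod_cast h1
    exact (sq_eq_sq₀ (norm_nonneg _) (norm_nonneg _)).1 h2
  let K : Submodule ℂ H := a.range.topologicalClosure
  have hK : IsClosed (K : Set H) := Submodule.isClosed_topologicalClosure _
  have : CompleteSpace K := hK.completeSpace_coe
  have hmem : ∀ ξ, a ξ ∈ K := fun ξ => Submodule.le_topologicalClosure _ ⟨ξ, rfl⟩
  let e : H →ₗ[ℂ] K := LinearMap.codRestrict K a.toLinearMap hmem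
  have hdense : DenseRange e := by
    refine Subtype.dense_iff.2 fun k hk => ?_
    have : (Subtype.val '' Set.range e : Set H) = (a.range : Set H) := by
      ext ξ
      constructor
      · rintro ⟨_, ⟨η, rfl⟩, rfl⟩
        exact ⟨η, rfl⟩
      · rintro ⟨η, rfl⟩
        exact ⟨e η, ⟨η, rfl⟩, rfl⟩
    exact closure_mono this.ge hk
  have hbd : ∀ ξ, ‖x.toLinearMap ξ‖ ≤ 1 * ‖e ξ‖ := fun ξ => by
    rw [one_mul]
    exact (hnorm ξ).le
  let v₀ : K →L[ℂ] H := x.toLinearMap.extendOfNorm e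
  have hv₀ : ∀ ξ, v₀ (e ξ) = x ξ := fun ξ => LinearMap.extendOfNorm_eq hdense ⟨1, hbd⟩ ξ
  let v : H →L[ℂ] H := v₀ ∘L K.orthogonalProjectionOnto
  have hva : ∀ ξ, v (a ξ) = x ξ := by
    intro ξ
    have : K.orthogonalProjectionOnto (a ξ) = e ξ :=
      Submodule.orthogonalProjectionOnto_mem_subspace_eq_self (K := K) (e ξ)
    change v₀ (K.orthogonalProjectionOnto (a ξ)) = x ξ
    rw [this, hv₀]
  have hvK : ∀ ξ ∈ Kᗮ, v ξ = 0 := by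
    intro ξ hξ
    change v₀ (K.orthogonalProjectionOnto ξ) = 0
    rw [Submodule.orthogonalProjectionOnto_eq_zero_iff.2 hξ, map_zero]
  have hv1 : ‖v‖ ≤ 1 := by
    refine (ContinuousLinearMap.opNorm_comp_le _ _).trans (mul_le_one₀ ?_ (norm_nonneg _) ?_)
    · exact LinearMap.opNorm_extendOfNorm_le hdense zero_le_one hbd
    · exact K.orthogonalProjectionOnto_norm_le
  have hker : ∀ ξ, ξ ∈ Kᗮ ↔ a ξ = 0 := by
    intro ξ
    rw [Submodule.orthogonal_closure, ContinuousLinearMap.orthogonal_range]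
    change star a ξ = 0 ↔ a ξ = 0
    rw [hsa]
  have hext : ∀ T : H →L[ℂ] H, T * a = 0 → (∀ ξ ∈ Kᗮ, T ξ = 0) → T = 0 := by
    intro T hT hT'
    have h1 : K ≤ T.ker := by
      refine Submodule.topologicalClosure_minimal _ ?_ T.isClosed_ker
      rintro _ ⟨η, rfl⟩
      exact congr_arg (fun S : H →L[ℂ] H => S η) hT
    ext ξ
    have h2 := hT' _ (Submodule.sub_starProjection_mem_orthogonal (K := K) ξ)
    have h3 : T (K.starProjection ξ) = 0 := h1 (K.orthogonalProjectionOnto ξ).2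
    rwa [map_sub, h3, sub_zero] at h2
  have hxv : x = v * a := by
    ext ξ
    exact (hva ξ).symm
  refine ⟨v, mem_of_commute fun g hg => ?_, hv1, hxv, ?_⟩
  · have hga := commute_of_mem (abs_mem hx) hg
    have hgx := commute_of_mem hx hg
    refine sub_eq_zero.1 (hext _ ?_ fun ξ hξ => ?_)
    · rw [sub_mul, mul_assoc, ← hxv, mul_assoc, ← hga.eq, ← mul_assoc, ← hxv, hgx.eq, sub_self]
    · have h1 : a (g ξ) = 0 := by
        have := congr_arg (fun S : H →L[ℂ] H => S ξ) hga.eq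
        change a (g ξ) = g (a ξ) at this
        rw [this, (hker ξ).1 hξ, map_zero]
      change g (v ξ) - v (g ξ) = 0
      rw [hvK ξ hξ, hvK _ ((hker _).2 h1), map_zero, sub_zero]
  · have h1 : a * (star v * x - a) = 0 := by
      have : a * star v = star x := by rw [hxv, star_mul, hsa]
      rw [mul_sub, ← mul_assoc, this, haa, sub_self]
    refine (sub_eq_zero.1 ?_).symm
    ext ξ
    set ζ := (star v * x - a) ξ with hζ
    have h2 : a ζ = 0 := congr_arg (fun S : H →L[ℂ] H => S ξ) h1
    have h3 : v ζ = 0 := hvK ζ ((hker ζ).2 h2)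
    have h4 : inner ℂ ζ ζ = 0 := by
      have e1 : inner ℂ ζ (star v (x ξ)) = 0 := by
        rw [ContinuousLinearMap.star_eq_adjoint, ContinuousLinearMap.adjoint_inner_right, h3,
          inner_zero_left]
      have e2 : inner ℂ ζ (a ξ) = 0 := by
        rw [← hsa, ContinuousLinearMap.star_eq_adjoint, ContinuousLinearMap.adjoint_inner_right,
          h2, inner_zero_left]
      nth_rewrite 2 [hζ]
      change inner ℂ ζ (star v (x ξ) - a ξ) = 0
      rw [inner_sub_right, e1, e2, sub_zero]
    exact inner_self_eq_zero.1 h4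

namespace NFSTrace

variable {N : VonNeumannAlgebra H} (τ : NFSTrace N)

theorem map_zero : τ.toFun 0 = 0 := by
  simpa using τ.map_smul 0 0 (zero_mem N) le_rfl

theorem mono {x y : H →L[ℂ] H} (hx : x ∈ N) (hy : y ∈ N) (h0 : 0 ≤ x) (h : x ≤ y) :
    τ.toFun x ≤ τ.toFun y := by
  have := τ.map_add x hx (y - x) (sub_mem hy hx) h0 (sub_nonneg.2 h)
  rw [add_sub_cancel] at this
  rw [this]
  exact le_self_add

/-- `τ(w* p w) ≤ τ(p)` for contractions `w`. -/
theorem conj_le {p w : H →L[ℂ] H} (hp : p ∈ N) (hp0 : 0 ≤ p) (hw : w ∈ N) (hw1 : ‖w‖ ≤ 1) :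
    τ.toFun (star w * p * w) ≤ τ.toFun p := by
  have hs := sqrt_mem hp
  have hss : CFC.sqrt p * CFC.sqrt p = p := CFC.sqrt_mul_sqrt_self p hp0
  have hsa : star (CFC.sqrt p) = CFC.sqrt p := (CFC.sqrt_nonneg p).isSelfAdjoint.star_eq
  have e1 : star w * p * w = star (CFC.sqrt p * w) * (CFC.sqrt p * w) := by
    rw [star_mul, hsa]
    conv_lhs => rw [← hss]
    noncomm_ring
  have e2 : (CFC.sqrt p * w) * star (CFC.sqrt p * w) = CFC.sqrt p * (w * star w) * CFC.sqrt p := by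
    rw [star_mul, hsa]
    noncomm_ring
  rw [e1, τ.tracial _ (mul_mem hs hw), e2]
  have hww : w * star w ≤ 1 := by
    have h0 : (0 : H →L[ℂ] H) ≤ w * star w := mul_star_self_nonneg w
    rw [← CStarAlgebra.norm_le_one_iff_of_nonneg _ h0, CStarRing.norm_self_mul_star]
    exact mul_le_one₀ hw1 (norm_nonneg _) hw1
  have h1 : CFC.sqrt p * (w * star w) * CFC.sqrt p ≤ p := by
    have := conjugate_le_conjugate_of_nonneg hww (CFC.sqrt_nonneg p)
    rwa [mul_one, hss] at this
  exact τ.mono (mul_mem (mul_mem hs (mul_mem hw (star_mem hw))) hs) hp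
    (conjugate_nonneg_of_nonneg (mul_star_self_nonneg w) (CFC.sqrt_nonneg p)) h1

/-- The operator inequality behind the triangle inequality. -/
theorem star_mul_add_le {x w v a : H →L[ℂ] H} (ha : 0 ≤ a) (hv : x = v * a) :
    star w * x + star x * w ≤ star w * v * a * star v * w + a := by
  have h := star_left_conjugate_nonneg ha (star v * w - 1)
  have hsa : star a = a := ha.isSelfAdjoint.star_eq
  rw [← sub_nonneg]
  convert h using 1
  rw [hv]
  simp only [star_sub, star_mul, star_star, star_one, hsa]
  noncomm_ring

theorem abs_add_le {x y : H →L[ℂ] H} (hx : x ∈ N) (hy : y ∈ N) :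
    τ.toFun (CFC.abs (x + y)) ≤ τ.toFun (CFC.abs x) + τ.toFun (CFC.abs y) := by
  obtain ⟨w, hw, hw1, -, hz⟩ := exists_polar (add_mem hx hy)
  obtain ⟨v, hv, hv1, hxv, -⟩ := exists_polar hx
  obtain ⟨u, hu, hu1, hyu, -⟩ := exists_polar hy
  have hax := abs_mem hx
  have hay := abs_mem hy
  have haz := abs_mem (add_mem hx hy)
  have key : CFC.abs (x + y) + CFC.abs (x + y) ≤
      (star (star v * w) * CFC.abs x * (star v * w) + CFC.abs x) +
      (star (star u * w) * CFC.abs y * (star u * w) + CFC.abs y) := by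
    have hsa : star (CFC.abs (x + y)) = CFC.abs (x + y) :=
      (CFC.abs_nonneg (x + y)).isSelfAdjoint.star_eq
    have h2 : CFC.abs (x + y) = star (x + y) * w := by
      conv_lhs => rw [← hsa, hz, star_mul, star_star]
    have e : CFC.abs (x + y) + CFC.abs (x + y) =
        (star w * x + star x * w) + (star w * y + star y * w) := by
      nth_rewrite 1 [hz]
      rw [h2, star_add]
      noncomm_ring
    rw [e]
    refine (add_le_add (star_mul_add_le (CFC.abs_nonneg x) hxv) (star_mul_add_le (CFC.abs_nonneg y) hyu)).trans_eq ?_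
    simp only [star_mul, star_star]
    noncomm_ring
  have hn : ∀ {a : H →L[ℂ] H}, ‖a‖ ≤ 1 → ‖star a * w‖ ≤ 1 := fun {a} ha =>
    (norm_mul_le _ _).trans (mul_le_one₀ (by rwa [norm_star]) (norm_nonneg _) hw1)
  have hvw := mul_mem (star_mem hv) hw
  have huw := mul_mem (star_mem hu) hw
  have m1 := mul_mem (mul_mem (star_mem hvw) hax) hvw
  have m2 := mul_mem (mul_mem (star_mem huw) hay) huw
  have p1 := star_left_conjugate_nonneg (CFC.abs_nonneg x) (star v * w)
  have p2 := star_left_conjugate_nonneg (CFC.abs_nonneg y) (star u * w)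
  have n1 := CFC.abs_nonneg x
  have n2 := CFC.abs_nonneg y
  have n3 := CFC.abs_nonneg (x + y)
  have h := τ.mono (add_mem haz haz) (add_mem (add_mem m1 hax) (add_mem m2 hay))
    (add_nonneg n3 n3) key
  rw [τ.map_add _ haz _ haz n3 n3, τ.map_add _ (add_mem m1 hax) _ (add_mem m2 hay)
    (add_nonneg p1 n1) (add_nonneg p2 n2), τ.map_add _ m1 _ hax p1 n1,
    τ.map_add _ m2 _ hay p2 n2] at h
  have h' : τ.toFun (CFC.abs (x + y)) + τ.toFun (CFC.abs (x + y)) ≤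
      (τ.toFun (CFC.abs x) + τ.toFun (CFC.abs y)) +
        (τ.toFun (CFC.abs x) + τ.toFun (CFC.abs y)) := by
    refine h.trans ?_
    calc _ ≤ (τ.toFun (CFC.abs x) + τ.toFun (CFC.abs x)) +
        (τ.toFun (CFC.abs y) + τ.toFun (CFC.abs y)) := by
          gcongr
          · exact τ.conj_le hax n1 hvw (hn hv1)
          · exact τ.conj_le hay n2 huw (hn hu1)
      _ = _ := by ring
  rw [← two_mul, ← two_mul] at h'
  exact (ENNReal.mul_le_mul_iff_right two_ne_zero ENNReal.ofNat_ne_top).1 h'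

theorem abs_mul_le {x y : H →L[ℂ] H} (hx : x ∈ N) (hy : y ∈ N) :
    τ.toFun (CFC.abs (x * y)) ≤ ‖x‖₊ * τ.toFun (CFC.abs y) := by
  have h : CFC.abs (x * y) ≤ ‖x‖₊ • CFC.abs y := by
    have e : ‖x‖₊ • CFC.abs y = CFC.abs ((‖x‖ : ℂ) • y) := by
      rw [CFC.abs_smul]
      simp
      rfl
    rw [e]
    refine CFC.sqrt_le_sqrt _ _ ?_
    have h1 := CStarAlgebra.star_left_conjugate_le_norm_smul (a := y) (b := star x * x)
      (IsSelfAdjoint.star_mul_self x)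
    rw [CStarRing.norm_star_mul_self] at h1
    convert h1 using 1
    · rw [star_mul]
      noncomm_ring
    · rw [star_smul, smul_mul_smul_comm, Complex.star_def, Complex.conj_ofReal, ← Complex.ofReal_mul]
      rfl
  rw [← τ.map_smul _ _ (abs_mem hy) (CFC.abs_nonneg y)]
  exact τ.mono (abs_mem (mul_mem hx hy)) (smul_mem ((‖x‖₊ : ℝ) : ℂ) (abs_mem hy))
    (CFC.abs_nonneg _) h

theorem abs_smul {x : H →L[ℂ] H} (c : ℂ) (hx : x ∈ N) :
    τ.toFun (CFC.abs (c • x)) = ‖c‖₊ * τ.toFun (CFC.abs x) := by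
  rw [CFC.abs_smul, ← τ.map_smul _ _ (abs_mem hx) (CFC.abs_nonneg x)]
  rfl

end NFSTrace

/-- The trace ideal `ℒ¹_τ(N) = {x ∈ N : τ(|x|) < ∞}`. -/
def L1 {N : VonNeumannAlgebra H} (τ : NFSTrace N) : Type _ :=
  {x : H →L[ℂ] H // x ∈ N ∧ τ.toFun (CFC.abs x) < ∞}

namespace L1

variable {N : VonNeumannAlgebra H} {τ : NFSTrace N}

variable (τ) in
/-- `ℒ¹_τ(N)` as a subalgebra of the bounded operators, without its norm. -/
def subalgebra : NonUnitalSubalgebra ℂ (H →L[ℂ] H) where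
  carrier := {x | x ∈ N ∧ τ.toFun (CFC.abs x) < ∞}
  zero_mem' := ⟨zero_mem N, by simp [τ.map_zero]⟩
  add_mem' hx hy := ⟨add_mem hx.1 hy.1,
    (τ.abs_add_le hx.1 hy.1).trans_lt (ENNReal.add_lt_top.2 ⟨hx.2, hy.2⟩)⟩
  mul_mem' hx hy := ⟨mul_mem hx.1 hy.1,
    (τ.abs_mul_le hx.1 hy.1).trans_lt (ENNReal.mul_lt_top ENNReal.coe_lt_top hy.2)⟩
  smul_mem' c x hx := ⟨smul_mem c hx.1, by
    rw [τ.abs_smul c hx.1]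
    exact ENNReal.mul_lt_top ENNReal.coe_lt_top hx.2⟩

instance : NonUnitalRing (L1 τ) := inferInstanceAs (NonUnitalRing (subalgebra τ))

instance : Module ℂ (L1 τ) := inferInstanceAs (Module ℂ (subalgebra τ))

instance : IsScalarTower ℂ (L1 τ) (L1 τ) :=
  inferInstanceAs (IsScalarTower ℂ (subalgebra τ) (subalgebra τ))

instance : SMulCommClass ℂ (L1 τ) (L1 τ) :=
  inferInstanceAs (SMulCommClass ℂ (subalgebra τ) (subalgebra τ))

@[simp] theorem val_zero : (0 : L1 τ).1 = 0 := rfl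
@[simp] theorem val_add (x y : L1 τ) : (x + y).1 = x.1 + y.1 := rfl
@[simp] theorem val_neg (x : L1 τ) : (-x).1 = -x.1 := rfl
@[simp] theorem val_sub (x y : L1 τ) : (x - y).1 = x.1 - y.1 := rfl
@[simp] theorem val_mul (x y : L1 τ) : (x * y).1 = x.1 * y.1 := rfl
@[simp] theorem val_smul (c : ℂ) (x : L1 τ) : (c • x).1 = c • x.1 := rfl

/-- `‖x‖_{1,∞} = ‖x‖ + τ(|x|)`. -/
instance : Norm (L1 τ) := ⟨fun x => ‖x.1‖ + (τ.toFun (CFC.abs x.1)).toReal⟩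

theorem norm_def (x : L1 τ) : ‖x‖ = ‖x.1‖ + (τ.toFun (CFC.abs x.1)).toReal := rfl

theorem core : NormedSpace.Core ℂ (L1 τ) where
  norm_nonneg x := by rw [norm_def]; positivity
  norm_smul c x := by
    rw [norm_def, norm_def, val_smul, norm_smul, τ.abs_smul c x.2.1, ENNReal.toReal_mul, mul_add]
    rfl
  norm_triangle x y := by
    have h := ENNReal.toReal_mono (ENNReal.add_ne_top.2 ⟨x.2.2.ne, y.2.2.ne⟩)
      (τ.abs_add_le x.2.1 y.2.1)
    rw [ENNReal.toReal_add x.2.2.ne y.2.2.ne] at h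
    simp only [norm_def, val_add]
    linarith [norm_add_le x.1 y.1]
  norm_eq_zero_iff x := by
    constructor
    · intro h
      rw [norm_def] at h
      have h1 := norm_nonneg x.1
      have h2 : 0 ≤ (τ.toFun (CFC.abs x.1)).toReal := ENNReal.toReal_nonneg
      exact Subtype.ext (norm_eq_zero.1 (by linarith))
    · rintro rfl
      simp [norm_def, τ.map_zero]

instance : NormedAddCommGroup (L1 τ) := NormedAddCommGroup.ofCore core

instance : NormedSpace ℂ (L1 τ) where
  norm_smul_le c x := (core.norm_smul c x).le

instance : NonUnitalNormedRing (L1 τ) where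
  dist_eq := NormedAddCommGroup.dist_eq
  norm_mul_le x y := by
    have h := ENNReal.toReal_mono (ENNReal.mul_ne_top ENNReal.coe_ne_top y.2.2.ne)
      (τ.abs_mul_le x.2.1 y.2.1)
    rw [ENNReal.toReal_mul, ENNReal.coe_toReal, coe_nnnorm] at h
    have h2 : 0 ≤ (τ.toFun (CFC.abs x.1)).toReal := ENNReal.toReal_nonneg
    have h3 : 0 ≤ (τ.toFun (CFC.abs y.1)).toReal := ENNReal.toReal_nonneg
    simp only [norm_def, val_mul]
    nlinarith [norm_mul_le x.1 y.1, mul_nonneg h2 (norm_nonneg y.1), mul_nonneg h2 h3]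

end L1

end TraceIdeal

end

noncomputable section

/-! ### Quasi-inverses and paths in `GLn A n` -/

namespace TopologicalK

section Banach

variable {A : Type*} [NonUnitalNormedRing A] [NormedSpace ℂ A]

/-! Every class in `GL_∞` comes from some g = 1 + x with x a matrix over the trace ideal, and g acts
on `Hⁿ` as an operator in `M_n(N)`. Since `M_n(ℒ¹_τ(N))` is a *-stable left ideal of `M_n(N)`, an
inverse of 1 + x on `Hⁿ` differs from 1 by an element of the ideal. So to join g to 1 it is enough
to find an entrywise continuous path of matrices over the ideal, from 0 to x, such that adding 1
always gives an invertible operator (`exists_subOne_eq_of_isUnit`, `mk_mem_of_isUnit_path`).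

Polar decomposition g = u|g| stays inside the group, because |g| - 1 = (1 + |g|)⁻¹(g*g - 1) is in
the ideal. The positive factor is joined to 1 by a segment. For the unitary factor the segment 1 +
t(u - 1) can fail to be invertible only because of the spectral value -1 at t = 1/2. Instead of
taking a logarithm, one bends the segment by t(1 - t) i w |u - 1|², where w is a symmetry in
`M_n(N)` with w · Im u ≥ 0: a sign of the imaginary part, deciding on which side of 0 to pass. The
factor |u - 1|² = 2 - u - u* keeps the correction in the ideal, although w - 1 need not be there.
With d = |u - 1|² and s = t(1 - t), the bent path f satisfies f f* = 3/4 + (s d - 1/2)² + 2 t²(1 -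
t) (w · Im u) d ≥ 3/4, so f is invertible (`mul_eq_of_commRing`, `isUnit_of_unitary`). -/

theorem map_inr_mul {n : ℕ} (a b : Matrix (Fin n) (Fin n) A) :
    (a * b).map (Unitization.inr : A → Unitization ℂ A) =
      a.map Unitization.inr * b.map Unitization.inr := by
  ext1 i j
  simp only [Matrix.map_apply, Matrix.mul_apply, ← Unitization.inr_mul]
  exact map_sum (Unitization.inrNonUnitalAlgHom ℂ A) _ _

variable [IsScalarTower ℂ A A] [SMulCommClass ℂ A A]

theorem one_add_map_inr_mul_eq_one {n : ℕ} {a b : Matrix (Fin n) (Fin n) A}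
    (h : a + b + a * b = 0) :
    (1 + a.map (Unitization.inr : A → Unitization ℂ A)) * (1 + b.map Unitization.inr) = 1 := by
  have h1 := congr_arg (fun m => m.map (Unitization.inr : A → Unitization ℂ A)) h
  simp only [Matrix.map_add _ (Unitization.inr_add ℂ), map_inr_mul] at h1
  rw [Matrix.map_zero _ (Unitization.inr_zero ℂ)] at h1
  calc _ = 1 + (a.map (Unitization.inr : A → Unitization ℂ A) + b.map Unitization.inr +
        a.map Unitization.inr * b.map Unitization.inr) := by noncomm_ring
    _ = 1 := by rw [h1, add_zero]

/-- A matrix `a` over `A` with a quasi-inverse is of the form `g - 1` with `g ∈ GL_n(A)`. -/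
theorem exists_subOne_eq {n : ℕ} {a b : Matrix (Fin n) (Fin n) A} (hab : a + b + a * b = 0)
    (hba : b + a + b * a = 0) : ∃ g : GLn A n, subOne g = a := by
  refine ⟨⟨⟨1 + a.map Unitization.inr, 1 + b.map Unitization.inr,
    one_add_map_inr_mul_eq_one hab, one_add_map_inr_mul_eq_one hba⟩, a, by simp⟩, ?_⟩
  ext i j
  simp [subOne]

theorem subOne_one {n : ℕ} : subOne (1 : GLn A n) = 0 := by
  ext i j
  simp [subOne]

namespace GLInf

/-- The metric on `GL_∞` sees only the entries of g - 1, so a path may be built in the space of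
matrices; inverses must exist along it, but their continuity need not be checked. -/
theorem mk_mem_pathComponentOne {n : ℕ} (g : GLn A n) (f : ℝ → Matrix (Fin n) (Fin n) A)
    (hf : Continuous f) (h0 : f 0 = 0) (h1 : f 1 = subOne g)
    (h : ∀ t ∈ Set.Icc (0 : ℝ) 1, ∃ k : GLn A n, subOne k = f t) :
    mk n g ∈ Subgroup.pathComponentOne (GLInf A) := by
  -- The lifts are chosen pointwise; `hk` and `dist_mk` turn their distances into those of `f`,
  -- which gives continuity.
  choose! k hk using h
  refine JoinedIn.joined (F := Set.univ) (JoinedIn.ofLine (f := fun t => mk n (k t)) ?_ ?_ ?_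
    (Set.subset_univ _))
  · refine continuousOn_iff_continuous_domRestrict.2 (continuous_iff_continuousAt.2 fun s => ?_)
    rw [ContinuousAt, tendsto_iff_dist_tendsto_zero]
    have hc : Continuous fun t : Set.Icc (0 : ℝ) 1 => ∑ i, ∑ j, ‖(f t - f s) i j‖ := by
      simp only [Matrix.sub_apply]
      fun_prop
    have := hc.tendsto s
    simp only [sub_self, Matrix.zero_apply, norm_zero, Finset.sum_const_zero] at this
    refine this.congr fun t => ?_
    rw [Set.domRestrict_apply, Set.domRestrict_apply, dist_mk, hk _ t.2, hk _ s.2]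
  · have : k 0 = 1 := subOne_injective A (by rw [hk 0 (by simp), h0, subOne_one])
    simp only [this, mk_one]
  · have : k 1 = g := subOne_injective A (by rw [hk 1 (by simp), h1])
    simp only [this]

end GLInf

end Banach

end TopologicalK

/-! ### Matrices of operators acting on `Hⁿ` -/

section BlockOp

variable {H : Type*} [NormedAddCommGroup H] [InnerProductSpace ℂ H]

namespace TraceIdeal

/-- A matrix of operators on `H` as an operator on the `ℓ²`-sum of copies of `H`. -/
def blockCLM {n : ℕ} : Matrix (Fin n) (Fin n) (H →L[ℂ] H) →+*
    (PiLp 2 (fun _ : Fin n => H) →L[ℂ] PiLp 2 (fun _ : Fin n => H)) where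
  toFun a := (PiLp.continuousLinearEquiv 2 ℂ (fun _ : Fin n => H)).symm.toContinuousLinearMap ∘L
    ContinuousLinearMap.pi fun i => ∑ j, a i j ∘L PiLp.proj 2 (fun _ : Fin n => H) j
  map_one' := by
    ext ξ i
    simp [Matrix.one_apply, apply_ite, ite_apply]
  map_mul' a b := by
    ext ξ i
    simp only [Matrix.mul_apply, mul_apply_eq_comp]
    simp
    exact Finset.sum_comm
  map_zero' := by
    ext ξ i
    simp
  map_add' a b := by
    ext ξ i
    simp [Finset.sum_add_distrib]

theorem blockCLM_apply {n : ℕ} (a : Matrix (Fin n) (Fin n) (H →L[ℂ] H))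
    (ξ : PiLp 2 (fun _ : Fin n => H)) (i : Fin n) : blockCLM a ξ i = ∑ j, a i j (ξ j) := by
  simp [blockCLM]

theorem blockCLM_smul {n : ℕ} (c : ℂ) (a : Matrix (Fin n) (Fin n) (H →L[ℂ] H)) :
    blockCLM (c • a) = c • blockCLM a := by
  ext ξ i
  simp [blockCLM_apply, Finset.smul_sum]

theorem blockCLM_bijective {n : ℕ} :
    Function.Bijective (blockCLM : Matrix (Fin n) (Fin n) (H →L[ℂ] H) → _) := by
  constructor
  · intro a b h
    ext i j ξ
    have := congr_arg (fun T => T (PiLp.single 2 j ξ) i) h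
    simpa [blockCLM_apply, Pi.single_apply, apply_ite] using this
  · intro T
    -- The entries of T are its compressions between coordinate inclusions and projections.
    refine ⟨Matrix.of fun i j => PiLp.proj 2 (fun _ : Fin n => H) i ∘L T ∘L
      (PiLp.continuousLinearEquiv 2 ℂ (fun _ : Fin n => H)).symm.toContinuousLinearMap ∘L
        ContinuousLinearMap.single ℂ (fun _ : Fin n => H) j, ?_⟩
    ext ξ i
    rw [blockCLM_apply]
    have : ξ = ∑ j, PiLp.single 2 j (ξ j) := by
      ext j
      simp
    conv_rhs => rw [this, map_sum]
    simp

variable (H) in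
/-- The Hilbert space `Hⁿ`. -/
def HilbertPow (n : ℕ) : Type _ := PiLp 2 (fun _ : Fin n => H)

instance (n : ℕ) : NormedAddCommGroup (HilbertPow H n) :=
  inferInstanceAs (NormedAddCommGroup (PiLp 2 (fun _ : Fin n => H)))

instance (n : ℕ) : InnerProductSpace ℂ (HilbertPow H n) :=
  inferInstanceAs (InnerProductSpace ℂ (PiLp 2 (fun _ : Fin n => H)))

/-- A matrix of operators on `H` as an operator on `Hⁿ`. -/
def blockOp {n : ℕ} :
    Matrix (Fin n) (Fin n) (H →L[ℂ] H) →+* (HilbertPow H n →L[ℂ] HilbertPow H n) :=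
  blockCLM

theorem blockOp_smul {n : ℕ} (c : ℂ) (a : Matrix (Fin n) (Fin n) (H →L[ℂ] H)) :
    blockOp (c • a) = c • blockOp a :=
  blockCLM_smul c a

theorem blockOp_bijective {n : ℕ} :
    Function.Bijective (blockOp : Matrix (Fin n) (Fin n) (H →L[ℂ] H) → _) :=
  blockCLM_bijective

variable [CompleteSpace H]

instance (n : ℕ) : CompleteSpace (HilbertPow H n) :=
  inferInstanceAs (CompleteSpace (PiLp 2 (fun _ : Fin n => H)))

theorem blockCLM_star {n : ℕ} (a : Matrix (Fin n) (Fin n) (H →L[ℂ] H)) :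
    blockCLM (star a) = star (blockCLM a) := by
  rw [ContinuousLinearMap.star_eq_adjoint, ContinuousLinearMap.eq_adjoint_iff]
  intro ξ η
  simp only [PiLp.inner_apply, blockCLM_apply, sum_inner, inner_sum]
  rw [Finset.sum_comm]
  refine Finset.sum_congr rfl fun i _ => Finset.sum_congr rfl fun j _ => ?_
  rw [Matrix.star_apply, ContinuousLinearMap.star_eq_adjoint,
    ContinuousLinearMap.adjoint_inner_left]

theorem blockOp_star {n : ℕ} (a : Matrix (Fin n) (Fin n) (H →L[ℂ] H)) :
    blockOp (star a) = star (blockOp a) :=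
  blockCLM_star a

/-- A diagonal matrix with constant entry c commutes with a exactly when c commutes with each entry;
the double commutant theorem does the rest. -/
theorem forall_mem_iff_commute {N : VonNeumannAlgebra H} {n : ℕ}
    {a : Matrix (Fin n) (Fin n) (H →L[ℂ] H)} :
    (∀ i j, a i j ∈ N) ↔
      ∀ c ∈ N.commutant, Commute (blockOp (Matrix.diagonal fun _ : Fin n => c)) (blockOp a) := by
  have key : ∀ c, Commute (blockOp (Matrix.diagonal fun _ : Fin n => c)) (blockOp a) ↔
      ∀ i j, Commute c (a i j) := fun c => by
    rw [commute_iff_eq, ← map_mul, ← map_mul, blockOp_bijective.1.eq_iff, ← Matrix.ext_iff]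
    simp [commute_iff_eq]
  simp only [key]
  exact ⟨fun h c hc i j => (commute_of_mem (h i j) hc).symm,
    fun h i j => mem_of_commute fun c hc => h c hc i j⟩

/-! ### Ideal and adjoint stability of the trace ideal -/

namespace NFSTrace

variable {N : VonNeumannAlgebra H} (τ : NFSTrace N)

/-- If x = v|x| is the polar decomposition, then |x*| = v|x|v*, and conjugating by a contraction
does not increase the trace. -/
theorem abs_star_le {x : H →L[ℂ] H} (hx : x ∈ N) :
    τ.toFun (CFC.abs (star x)) ≤ τ.toFun (CFC.abs x) := by
  obtain ⟨v, hv, hv1, hxv, hvx⟩ := exists_polar hx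
  have ha := CFC.abs_nonneg x
  have hsa : star (CFC.abs x) = CFC.abs x := ha.isSelfAdjoint.star_eq
  have h : CFC.abs (star x) = star (star v) * CFC.abs x * star v := by
    refine CFC.sqrt_unique ?_ (star_left_conjugate_nonneg ha _)
    calc _ = v * CFC.abs x * (star v * (v * CFC.abs x)) * star v := by
          rw [star_star]; noncomm_ring
      _ = v * CFC.abs x * star (v * CFC.abs x) := by
          rw [← hxv, ← hvx, hxv, star_mul, hsa, ← hxv, mul_assoc]
      _ = _ := by rw [← hxv, star_star]
  rw [h]
  exact τ.conj_le (abs_mem hx) ha (star_mem hv) (by rwa [norm_star])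

end NFSTrace

namespace L1

variable {N : VonNeumannAlgebra H} (τ : NFSTrace N)

theorem mul_mem_subalgebra {x y : H →L[ℂ] H} (hx : x ∈ N) (hy : y ∈ subalgebra τ) :
    x * y ∈ subalgebra τ :=
  ⟨mul_mem hx hy.1, (τ.abs_mul_le hx hy.1).trans_lt (ENNReal.mul_lt_top ENNReal.coe_lt_top hy.2)⟩

theorem star_mem_subalgebra {x : H →L[ℂ] H} (hx : x ∈ subalgebra τ) : star x ∈ subalgebra τ :=
  ⟨star_mem hx.1, (τ.abs_star_le hx.1).trans_lt hx.2⟩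

end L1

end TraceIdeal

end BlockOp

/-! ### Invertible paths in C*-algebras -/

section Unitary

/-- For a selfadjoint operator `b` there is a symmetry `w` with `w b = |b|`, which commutes with all
operators that commute with `b`. -/
theorem exists_symmetry_mul_nonneg {K : Type*} [NormedAddCommGroup K] [InnerProductSpace ℂ K]
    [CompleteSpace K] {b : K →L[ℂ] K} (hb : IsSelfAdjoint b) :
    ∃ w : K →L[ℂ] K, IsSelfAdjoint w ∧ w * w = 1 ∧ 0 ≤ w * b ∧
      ∀ T : K →L[ℂ] K, Commute T b → Commute T w := by
  set a := CFC.abs b with ha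
  have haa : a * a = b * b := by rw [ha, CFC.abs_mul_abs, hb.star_eq]
  have ha0 : 0 ≤ a := CFC.abs_nonneg b
  have hstar : ∀ T : K →L[ℂ] K, Commute T b → Commute (star T) b := fun T h => by
    have := h.star_star
    rwa [hb.star_eq] at this
  have hT : ∀ T : K →L[ℂ] K, Commute T b → Commute T a := fun T h =>
    (h.symm.cfcAbs_left (hstar T h).symm).symm
  have hab : Commute a b := (hT b (Commute.refl b)).symm
  set c := a - b with hc
  have hcs : IsSelfAdjoint c := ha0.isSelfAdjoint.sub hb
  have : CompleteSpace c.ker := c.isClosed_ker.completeSpace_coe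
  -- The symmetry will be 2p - 1, with p the projection onto the kernel of c = |b| - b. Since c(|b|
  -- + b) = 0, p fixes |b| + b and kills c, whence (2p - 1)b = |b|.
  set p : K →L[ℂ] K := c.ker.starProjection with hp
  have hps : IsSelfAdjoint p := isSelfAdjoint_starProjection _
  have hpp : p * p = p := c.ker.isIdempotentElem_starProjection
  have hcp : c * p = 0 := by
    ext ξ
    exact (c.ker.orthogonalProjectionOnto ξ).2
  have hpc : p * c = 0 := by
    have := congr_arg star hcp
    rwa [star_mul, hcs.star_eq, hps.star_eq, star_zero] at this
  have hfix : ∀ T : K →L[ℂ] K, c * T = 0 → p * T = T := fun T h => by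
    ext ξ
    refine Submodule.starProjection_eq_self_iff.2 ?_
    exact congr_arg (fun S : K →L[ℂ] K => S ξ) h
  have hpab : p * (a + b) = a + b := by
    refine hfix _ ?_
    rw [hc, sub_mul, mul_add, mul_add, haa, hab.eq]
    abel
  have hinv : ∀ T : K →L[ℂ] K, Commute T b → p * (T * p) = T * p := fun T h => by
    refine hfix _ ?_
    rw [← mul_assoc, ← (((hT T h).sub_right h).eq : T * c = c * T), mul_assoc, hcp, mul_zero]
  -- The range of p is invariant under both T and T*, hence reduces T.
  have hcomm : ∀ T : K →L[ℂ] K, Commute T b → Commute T p := fun T h => by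
    have h1 := congr_arg star (hinv _ (hstar T h))
    rw [star_mul, star_mul, star_star, hps.star_eq, mul_assoc, hinv T h] at h1
    exact h1
  refine ⟨p + p - 1, (hps.add hps).sub (.one _), ?_, ?_, fun T h =>
    ((hcomm T h).add_right (hcomm T h)).sub_right (Commute.one_right T)⟩
  · have : (p + p - 1) * (p + p - 1) = p * p + p * p + p * p + p * p - p - p - p - p + 1 := by
      noncomm_ring
    rw [this, hpp]
    abel
  · have : (p + p - 1) * b = a := by
      have h1 : (p + p - 1) * b = p * (a + b) - p * c - b := by rw [hc]; noncomm_ring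
      rw [h1, hpab, hpc]
      abel
    rwa [this]

/-- The square of the absolute value of the path `1 + t (u - 1) + t (1 - t) i w |u - 1|²` for a
unitary `u` and a symmetry `w`, with `v` in the place of `u*`. -/
theorem mul_eq_of_commRing {S : Type*} [CommRing S] [Algebra ℂ S] {u v w : S} (huv : u * v = 1)
    (hw : w * w = 1) (t : ℂ) :
    (1 + t • (u - 1) + (t * (1 - t) * Complex.I) • (w * (2 - u - v))) *
      (1 + t • (v - 1) - (t * (1 - t) * Complex.I) • (w * (2 - u - v))) =
    algebraMap ℂ S (3 / 4) +
      (((t * (1 - t)) • (2 - u - v) - algebraMap ℂ S (1 / 2)) *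
        ((t * (1 - t)) • (2 - u - v) - algebraMap ℂ S (1 / 2)) +
      (2 * t ^ 2 * (1 - t)) • (w * ((-(Complex.I / 2)) • (u - v)) * (2 - u - v))) := by
  have hJ : algebraMap ℂ S Complex.I * algebraMap ℂ S Complex.I = -1 := by
    rw [← map_mul, Complex.I_mul_I, map_neg, map_one]
  have hh : 2 * algebraMap ℂ S (1 / 2) = 1 := by
    rw [← map_ofNat (algebraMap ℂ S) 2, ← map_mul]
    norm_num
  -- All rational constants are expressed through h = 1/2, so that 2h = 1 is the only relation
  -- needed for them.
  have h3 : algebraMap ℂ S (3 / 4) = 3 * algebraMap ℂ S (1 / 2) ^ 2 := by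
    rw [← map_ofNat (algebraMap ℂ S) 3, ← map_pow, ← map_mul]
    norm_num
  rw [h3, show -(Complex.I / 2) = -(Complex.I * (1 / 2)) by ring]
  simp only [Algebra.smul_def, map_mul, map_sub, map_one, map_pow, map_neg, map_ofNat]
  set T := algebraMap ℂ S t
  set J := algebraMap ℂ S Complex.I
  set h := algebraMap ℂ S (1 / 2)
  linear_combination T ^ 2 * huv -
    T ^ 2 * (1 - T) ^ 2 * (2 - u - v) ^ 2 * (J ^ 2 * hw + hJ) +
    (-(2 * h + 1) + T * (1 - T) * (2 - u - v) +
      T ^ 2 * (1 - T) * J * w * (u - v) * (2 - u - v)) * hh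

open scoped IsMulCommutative in
-- The elements u, v, w commute pairwise, so the commutative identity can be applied in the
-- subalgebra they generate.
theorem mul_eq_of_commute {B : Type*} [Ring B] [Algebra ℂ B] {u v w : B} (huv : u * v = 1)
    (hvu : v * u = 1) (hw : w * w = 1) (hwu : Commute w u) (hwv : Commute w v) (t : ℂ) :
    (1 + t • (u - 1) + (t * (1 - t) * Complex.I) • (w * (2 - u - v))) *
      (1 + t • (v - 1) - (t * (1 - t) * Complex.I) • (w * (2 - u - v))) =
    algebraMap ℂ B (3 / 4) +
      (((t * (1 - t)) • (2 - u - v) - algebraMap ℂ B (1 / 2)) *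
        ((t * (1 - t)) • (2 - u - v) - algebraMap ℂ B (1 / 2)) +
      (2 * t ^ 2 * (1 - t)) • (w * ((-(Complex.I / 2)) • (u - v)) * (2 - u - v))) ∧
    (1 + t • (v - 1) - (t * (1 - t) * Complex.I) • (w * (2 - u - v))) *
      (1 + t • (u - 1) + (t * (1 - t) * Complex.I) • (w * (2 - u - v))) =
    (1 + t • (u - 1) + (t * (1 - t) * Complex.I) • (w * (2 - u - v))) *
      (1 + t • (v - 1) - (t * (1 - t) * Complex.I) • (w * (2 - u - v))) ∧
    Commute (w * ((-(Complex.I / 2)) • (u - v))) (2 - u - v) := by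
  have hc : ∀ x ∈ ({u, v, w} : Set B), ∀ y ∈ ({u, v, w} : Set B), x * y = y * x := by
    have h1 := hwu.eq
    have h2 := hwv.eq
    rintro x (rfl | rfl | rfl) y (rfl | rfl | rfl) <;> simp_all
  let S := Algebra.adjoin ℂ ({u, v, w} : Set B)
  have : IsMulCommutative S := Algebra.isMulCommutative_adjoin ℂ hc
  let u' : S := ⟨u, Algebra.subset_adjoin (by simp)⟩
  let v' : S := ⟨v, Algebra.subset_adjoin (by simp)⟩
  let w' : S := ⟨w, Algebra.subset_adjoin (by simp)⟩
  refine ⟨?_, ?_, ?_⟩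
  · exact congr_arg (Subtype.val : S → B)
      (mul_eq_of_commRing (u := u') (v := v') (w := w') (Subtype.ext huv) (Subtype.ext hw) t)
  · exact congr_arg (Subtype.val : S → B) (mul_comm
      (1 + t • (v' - 1) - (t * (1 - t) * Complex.I) • (w' * (2 - u' - v')))
      (1 + t • (u' - 1) + (t * (1 - t) * Complex.I) • (w' * (2 - u' - v'))))
  · exact congr_arg (Subtype.val : S → B)
      (mul_comm (w' * ((-(Complex.I / 2)) • (u' - v'))) (2 - u' - v'))

/-- The path element commutes with its adjoint, and their product is 3/4 plus a square of a
selfadjoint element plus a nonnegative multiple of a product of commuting positive elements. An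
invertible product of commuting factors has invertible factors. -/
theorem isUnit_of_unitary {B : Type*} [CStarAlgebra B] [PartialOrder B] [StarOrderedRing B]
    {u w : B} (hu : u ∈ unitary B) (hw : IsSelfAdjoint w) (hww : w * w = 1) (hwu : Commute w u)
    (hpos : 0 ≤ w * ((-(Complex.I / 2)) • (u - star u))) {t : ℝ} (h1 : t ≤ 1) :
    IsUnit (1 + (t : ℂ) • (u - 1) +
      ((t : ℂ) * (1 - t) * Complex.I) • (w * (2 - u - star u))) := by
  have hwv : Commute w (star u) := by
    have := hwu.star_star
    rwa [hw.star_eq] at this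
  obtain ⟨e1, e2, e3⟩ := mul_eq_of_commute (Unitary.mul_star_self_of_mem hu)
    (Unitary.star_mul_self_of_mem hu) hww hwu hwv (t : ℂ)
  have hd : 0 ≤ 2 - u - star u := by
    have h := star_mul_self_nonneg (u - 1)
    have e : star (u - 1) * (u - 1) = star u * u + 1 - u - star u := by
      rw [star_sub, star_one]
      noncomm_ring
    rwa [e, Unitary.star_mul_self_of_mem hu, one_add_one_eq_two] at h
  have hs : IsSelfAdjoint (((t : ℂ) * (1 - t)) • (2 - u - star u) - algebraMap ℂ B (1 / 2)) := by
    refine IsSelfAdjoint.sub (.smul ?_ hd.isSelfAdjoint) ?_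
    · simp [isSelfAdjoint_iff]
    · simp [isSelfAdjoint_iff, ← algebraMap_star_comm]
  have hr : 0 ≤ (2 * (t : ℂ) ^ 2 * (1 - t)) •
      (w * ((-(Complex.I / 2)) • (u - star u)) * (2 - u - star u)) := by
    have h : (0 : ℝ) ≤ 2 * t ^ 2 * (1 - t) := by have := sub_nonneg.2 h1; positivity
    have h' := smul_nonneg h (e3.mul_nonneg hpos hd)
    rw [← Complex.coe_smul] at h'
    exact_mod_cast h'
  have hunit : IsUnit (algebraMap ℂ B (3 / 4)) := (IsUnit.mk0 (3 / 4 : ℂ) (by norm_num)).map _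
  have h34 : 0 ≤ algebraMap ℂ B (3 / 4) := by
    rw [Algebra.algebraMap_eq_smul_one]
    have h := smul_nonneg (by norm_num : (0 : ℝ) ≤ 3 / 4) (zero_le_one (α := B))
    rw [← Complex.coe_smul] at h
    norm_num at h
    exact h
  have h := CStarAlgebra.isUnit_of_le _
    (le_add_of_nonneg_right (add_nonneg hs.mul_self_nonneg hr)) (hunit.isStrictlyPositive h34)
  rw [← e1] at h
  exact ((Commute.isUnit_mul_iff e2.symm).1 h).1

theorem isUnit_of_nonneg {B : Type*} [CStarAlgebra B] [PartialOrder B] [StarOrderedRing B]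
    {p : B} (hp : 0 ≤ p) (hu : IsUnit p) {t : ℝ} (h0 : 0 ≤ t) (h1 : t ≤ 1) :
    IsUnit (1 + (t : ℂ) • (p - 1)) := by
  have e : 1 + (t : ℂ) • (p - 1) = (1 - t) • 1 + t • p := by
    rw [Complex.coe_smul, smul_sub, sub_smul, one_smul]
    abel
  rw [e]
  -- The lower bound 1 - t degenerates at t = 1, where the element is p itself.
  rcases h1.eq_or_lt with rfl | h1
  · simpa using hu
  · refine CStarAlgebra.isUnit_of_le _ (le_add_of_nonneg_right (smul_nonneg h0 hp)) ?_
    refine IsUnit.isStrictlyPositive ?_ (smul_nonneg (by linarith) zero_le_one)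
    rw [← Algebra.algebraMap_eq_smul_one]
    exact (IsUnit.mk0 (1 - t) (by linarith)).map _

theorem isSelfAdjoint_neg_I_div_two_smul {B : Type*} [CStarAlgebra B] (u : B) :
    IsSelfAdjoint ((-(Complex.I / 2)) • (u - star u)) := by
  rw [isSelfAdjoint_iff, star_smul, star_sub, star_star, ← neg_sub u, smul_neg, ← neg_smul]
  congr 1
  simp [neg_div]

theorem isUnit_abs {B : Type*} [CStarAlgebra B] [PartialOrder B] [StarOrderedRing B] {g : B}
    (hg : IsUnit g) : IsUnit (CFC.abs g) := by
  have h : IsUnit (CFC.abs g * CFC.abs g) := by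
    rw [CFC.abs_mul_abs]
    exact hg.star.mul hg
  exact ((Commute.refl _).isUnit_mul_iff.1 h).1

/-- Here q = |g|⁻¹, so g q is the polar part of g: it is an invertible isometry. -/
theorem mul_mem_unitary_of_abs {B : Type*} [CStarAlgebra B] [PartialOrder B] [StarOrderedRing B]
    {g q : B} (hg : IsUnit g) (h1 : CFC.abs g * q = 1) (h2 : q * CFC.abs g = 1) :
    g * q ∈ unitary B := by
  have hs : star (CFC.abs g) = CFC.abs g := (CFC.abs_nonneg g).isSelfAdjoint.star_eq
  have h3 : star q * CFC.abs g = 1 := by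
    have := congr_arg star h1
    rwa [star_mul, hs, star_one] at this
  have h4 : star (g * q) * (g * q) = 1 := by
    calc _ = star q * (star g * g) * q := by rw [star_mul]; noncomm_ring
      _ = (star q * CFC.abs g) * (CFC.abs g * q) := by rw [← CFC.abs_mul_abs]; noncomm_ring
      _ = 1 := by rw [h3, h1, one_mul]
  have hu : IsUnit (g * q) := hg.mul ⟨⟨q, CFC.abs g, h2, h1⟩, rfl⟩
  refine ⟨h4, ?_⟩
  have e : star (g * q) * hu.unit = 1 := h4
  rw [← Units.inv_eq_of_mul_eq_one_left e]
  exact hu.mul_val_inv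

/-- From |1 + x|² - 1 = (1 + |1 + x|)(|1 + x| - 1), where the first factor is at least 1. This
exhibits |1 + x| - 1 as a multiple of an element of any *-stable left ideal containing x. -/
theorem abs_sub_one_eq {B : Type*} [CStarAlgebra B] [PartialOrder B] [StarOrderedRing B] (x : B) :
    ∃ U : Bˣ, (U : B) = 1 + CFC.abs (1 + x) ∧
      CFC.abs (1 + x) - 1 = ↑U⁻¹ * (x + star x + star x * x) := by
  have h : IsUnit (1 + CFC.abs (1 + x)) :=
    CStarAlgebra.isUnit_of_le 1 (le_add_of_nonneg_right (CFC.abs_nonneg _))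
      (isUnit_one.isStrictlyPositive zero_le_one)
  refine ⟨h.unit, rfl, ?_⟩
  have e : x + star x + star x * x =
      (1 + CFC.abs (1 + x)) * (CFC.abs (1 + x) - 1) := by
    have h1 : (1 + CFC.abs (1 + x)) * (CFC.abs (1 + x) - 1) =
      CFC.abs (1 + x) * CFC.abs (1 + x) - 1 := by noncomm_ring
    rw [h1, CFC.abs_mul_abs, star_add, star_one]
    noncomm_ring
  rw [e, ← mul_assoc, IsUnit.val_inv_mul, one_mul]

/-- For unitary u = 1 + x the right side is |u - 1|², so |u - 1|² is linear in x and x* and lies in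
the ideal. -/
theorem neg_one_smul_add_star {B : Type*} [CStarAlgebra B] (x : B) :
    (-1 : ℂ) • (x + star x) = 2 - (1 + x) - star (1 + x) := by
  rw [star_add, star_one, ← one_add_one_eq_two, neg_one_smul]
  abel

end Unitary

open TopologicalK

namespace TraceIdeal

variable {H : Type*} [NormedAddCommGroup H] [InnerProductSpace ℂ H] [CompleteSpace H]

/-! ### Contracting `GL_n` of the trace ideal -/

namespace L1

variable {N : VonNeumannAlgebra H} {τ : NFSTrace N} {n : ℕ}

/-- A matrix over `ℒ¹_τ(N)` as an operator on `Hⁿ`. -/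
def toOp (x : Matrix (Fin n) (Fin n) (L1 τ)) :
    HilbertPow H n →L[ℂ] HilbertPow H n :=
  blockOp (x.map Subtype.val)

theorem toOp_injective : Function.Injective (toOp : Matrix (Fin n) (Fin n) (L1 τ) → _) :=
  fun _ _ h => Matrix.map_injective Subtype.val_injective (blockOp_bijective.1 h)

theorem toOp_zero : toOp (0 : Matrix (Fin n) (Fin n) (L1 τ)) = 0 := by
  rw [toOp, Matrix.map_zero _ val_zero, map_zero]

theorem toOp_add (x y : Matrix (Fin n) (Fin n) (L1 τ)) : toOp (x + y) = toOp x + toOp y := by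
  rw [toOp, Matrix.map_add _ val_add, map_add, toOp, toOp]

theorem toOp_smul (c : ℂ) (x : Matrix (Fin n) (Fin n) (L1 τ)) : toOp (c • x) = c • toOp x := by
  rw [toOp, toOp, ← blockOp_smul]
  rfl

theorem toOp_mul (x y : Matrix (Fin n) (Fin n) (L1 τ)) : toOp (x * y) = toOp x * toOp y := by
  rw [toOp, toOp, toOp, ← map_mul]
  congr 1
  ext1 i j
  simp only [Matrix.mul_apply]
  exact map_sum (subalgebra τ).subtype _ _

theorem exists_toOp_eq {a : Matrix (Fin n) (Fin n) (H →L[ℂ] H)}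
    (ha : ∀ i j, a i j ∈ subalgebra τ) : ∃ x : Matrix (Fin n) (Fin n) (L1 τ), toOp x = blockOp a :=
  ⟨Matrix.of fun i j => ⟨a i j, ha i j⟩, rfl⟩

variable (N n) in
/-- The von Neumann algebra `M_n(N)` acting on `Hⁿ`, as the commutant of the diagonal copy
of `N'`. -/
def matrixAlgebra : StarSubalgebra ℂ
    (HilbertPow H n →L[ℂ] HilbertPow H n) :=
  StarSubalgebra.centralizer ℂ
    ((fun c => blockOp (Matrix.diagonal fun _ : Fin n => c)) '' (N.commutant : Set (H →L[ℂ] H)))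

theorem mem_matrixAlgebra_iff
    {T : HilbertPow H n →L[ℂ] HilbertPow H n} :
    T ∈ matrixAlgebra N n ↔
      ∀ c ∈ N.commutant, Commute (blockOp (Matrix.diagonal fun _ : Fin n => c)) T := by
  rw [matrixAlgebra, StarSubalgebra.mem_centralizer_iff]
  constructor
  · intro h c hc
    exact (h _ ⟨c, hc, rfl⟩).1
  · rintro h _ ⟨c, hc, rfl⟩
    -- The centralizer also asks for commutation with adjoints, which is automatic because the
    -- commutant of N is *-closed.
    refine ⟨h c hc, ?_⟩
    have e : star (Matrix.diagonal fun _ : Fin n => c) = Matrix.diagonal fun _ : Fin n => star c := by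
      rw [Matrix.star_eq_conjTranspose, Matrix.diagonal_conjTranspose]
      rfl
    rw [← blockOp_star, e]
    exact h _ (star_mem hc)

theorem blockOp_mem_matrixAlgebra_iff {a : Matrix (Fin n) (Fin n) (H →L[ℂ] H)} :
    blockOp a ∈ matrixAlgebra N n ↔ ∀ i j, a i j ∈ N := by
  rw [mem_matrixAlgebra_iff, forall_mem_iff_commute]

theorem toOp_mem_matrixAlgebra (x : Matrix (Fin n) (Fin n) (L1 τ)) :
    toOp x ∈ matrixAlgebra N n :=
  blockOp_mem_matrixAlgebra_iff.2 fun i j => (x i j).2.1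

variable {T S : HilbertPow H n →L[ℂ] HilbertPow H n}

/-- Inverses, absolute values and the symmetry w enter `M_n(N)` this way: each commutes with
whatever commutes with the given operator and its adjoint. -/
theorem mem_matrixAlgebra_of_commute (hT : T ∈ matrixAlgebra N n)
    (h : ∀ R, Commute R T → Commute R (star T) → Commute R S) : S ∈ matrixAlgebra N n :=
  mem_matrixAlgebra_iff.2 fun c hc => h _ (mem_matrixAlgebra_iff.1 hT c hc)
    (mem_matrixAlgebra_iff.1 (star_mem hT) c hc)

theorem mul_mem_range_toOp (hT : T ∈ matrixAlgebra N n)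
    (hS : S ∈ Set.range (toOp : Matrix (Fin n) (Fin n) (L1 τ) → _)) :
    T * S ∈ Set.range (toOp : Matrix (Fin n) (Fin n) (L1 τ) → _) := by
  obtain ⟨x, rfl⟩ := hS
  obtain ⟨a, rfl⟩ := blockOp_bijective.2 T
  rw [toOp, ← map_mul]
  refine exists_toOp_eq fun i j => ?_
  rw [Matrix.mul_apply]
  exact sum_mem fun k _ => mul_mem_subalgebra τ (blockOp_mem_matrixAlgebra_iff.1 hT i k) (x k j).2

theorem star_mem_range_toOp (hS : S ∈ Set.range (toOp : Matrix (Fin n) (Fin n) (L1 τ) → _)) :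
    star S ∈ Set.range (toOp : Matrix (Fin n) (Fin n) (L1 τ) → _) := by
  obtain ⟨x, rfl⟩ := hS
  rw [toOp, ← blockOp_star]
  exact exists_toOp_eq fun i j => star_mem_subalgebra τ (x j i).2

/-- Because (1 + x)⁻¹ - 1 = -(1 + x)⁻¹ x, with (1 + x)⁻¹ in `M_n(N)`, the quasi-inverse of x is
again a matrix over the ideal. -/
theorem exists_subOne_eq_of_isUnit {x : Matrix (Fin n) (Fin n) (L1 τ)} (h : IsUnit (1 + toOp x)) :
    ∃ g : GLn (L1 τ) n, subOne g = x := by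
  obtain ⟨U, hU⟩ := h
  have hM : (↑U⁻¹ : HilbertPow H n →L[ℂ] HilbertPow H n) ∈
      matrixAlgebra N n :=
    mem_matrixAlgebra_of_commute (add_mem (one_mem _) (toOp_mem_matrixAlgebra x)) fun R hR _ =>
      Commute.units_inv_right (by rwa [hU])
  obtain ⟨y, hy⟩ := mul_mem_range_toOp (neg_mem hM) ⟨x, rfl⟩
  have hy' : 1 + toOp y = ↑U⁻¹ := by
    have := U.inv_mul
    rw [hU, mul_add, mul_one] at this
    rw [hy, neg_mul, ← this]
    abel
  refine exists_subOne_eq (b := y) (toOp_injective ?_) (toOp_injective ?_)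
  · have h1 := U.mul_inv
    rw [hU, ← hy', ← sub_eq_zero] at h1
    rw [toOp_add, toOp_add, toOp_mul, toOp_zero, ← h1]
    noncomm_ring
  · have h1 := U.inv_mul
    rw [hU, ← hy', ← sub_eq_zero] at h1
    rw [toOp_add, toOp_add, toOp_mul, toOp_zero, ← h1]
    noncomm_ring

/-- The representation of `GL_n(ℒ¹_τ(N))` on `Hⁿ`. -/
def repr : GLn (L1 τ) n →* (HilbertPow H n →L[ℂ] HilbertPow H n) where
  toFun g := 1 + toOp (subOne g)
  map_one' := by rw [subOne_one, toOp_zero, add_zero]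
  map_mul' g k := by
    rw [subOne_mul, toOp_add, toOp_add, toOp_mul]
    noncomm_ring

theorem repr_apply (g : GLn (L1 τ) n) : repr g = 1 + toOp (subOne g) := rfl

theorem repr_mem (g : GLn (L1 τ) n) : repr g ∈ matrixAlgebra N n :=
  add_mem (one_mem _) (toOp_mem_matrixAlgebra _)

theorem isUnit_repr (g : GLn (L1 τ) n) : IsUnit (repr g) :=
  (Group.isUnit g).map repr

/-- The coefficient t(1 - t) makes the correction S vanish at both ends; S = 0 gives the straight
segment. -/
theorem mk_mem_of_isUnit_path (g : GLn (L1 τ) n)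
    (hS : S ∈ Set.range (toOp : Matrix (Fin n) (Fin n) (L1 τ) → _))
    (h : ∀ t : ℝ, 0 ≤ t → t ≤ 1 →
      IsUnit (1 + (t : ℂ) • (repr g - 1) + ((t : ℂ) * (1 - t) * Complex.I) • S)) :
    GLInf.mk n g ∈ Subgroup.pathComponentOne (GLInf (L1 τ)) := by
  obtain ⟨y, rfl⟩ := hS
  refine GLInf.mk_mem_pathComponentOne g
    (fun t : ℝ => (t : ℂ) • subOne g + ((t : ℂ) * (1 - t) * Complex.I) • y) ?_ ?_ ?_ ?_
  · refine continuous_matrix fun i j => ?_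
    simp only [Matrix.add_apply, Matrix.smul_apply]
    fun_prop
  · simp
  · simp
  · intro t ht
    refine exists_subOne_eq_of_isUnit ?_
    have := h t ht.1 ht.2
    rwa [repr_apply, add_sub_cancel_left, ← toOp_smul, ← toOp_smul, add_assoc, ← toOp_add] at this

theorem mk_mem_of_nonneg (g : GLn (L1 τ) n) (hg : 0 ≤ repr g) :
    GLInf.mk n g ∈ Subgroup.pathComponentOne (GLInf (L1 τ)) := by
  refine mk_mem_of_isUnit_path (S := toOp 0) g ⟨0, rfl⟩ fun t h0 h1 => ?_
  rw [← toOp_smul, smul_zero, toOp_zero, add_zero]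
  exact isUnit_of_nonneg hg (isUnit_repr g) h0 h1

theorem mk_mem_of_unitary (g : GLn (L1 τ) n) (hg : repr g ∈ unitary
    (HilbertPow H n →L[ℂ] HilbertPow H n)) :
    GLInf.mk n g ∈ Subgroup.pathComponentOne (GLInf (L1 τ)) := by
  obtain ⟨w, hw, hww, hpos, hcomm⟩ :=
    exists_symmetry_mul_nonneg (isSelfAdjoint_neg_I_div_two_smul (repr g))
  -- A unitary is normal, so it commutes with its imaginary part and therefore with w.
  have hwu : Commute w (repr g) := by
    refine (hcomm _ (Commute.smul_right ((Commute.refl _).sub_right ?_) _)).symm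
    exact (Unitary.mul_star_self_of_mem hg).trans (Unitary.star_mul_self_of_mem hg).symm
  have hwM : w ∈ matrixAlgebra N n := mem_matrixAlgebra_of_commute (repr_mem g)
    fun R h1 h2 => hcomm R ((h1.sub_right h2).smul_right _)
  refine mk_mem_of_isUnit_path (S := w * (2 - repr g - star (repr g))) g
    (mul_mem_range_toOp hwM ?_) fun t _ h1 => isUnit_of_unitary hg hw hww hwu hpos h1
  obtain ⟨y, hy⟩ := star_mem_range_toOp ⟨subOne g, rfl⟩
  refine ⟨(-1 : ℂ) • (subOne g + y), ?_⟩
  rw [toOp_smul, toOp_add, hy]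
  exact neg_one_smul_add_star _

theorem exists_repr_eq_abs (g : GLn (L1 τ) n) :
    ∃ k : GLn (L1 τ) n, repr k = CFC.abs (repr g) := by
  obtain ⟨U, hU, hP⟩ := abs_sub_one_eq (toOp (subOne g))
  have hM : (↑U⁻¹ : HilbertPow H n →L[ℂ] HilbertPow H n) ∈
      matrixAlgebra N n := by
    refine mem_matrixAlgebra_of_commute (repr_mem g) fun R h1 h2 => Commute.units_inv_right ?_
    rw [hU]
    refine (Commute.one_right R).add_right (Commute.cfcAbs_left h1.symm ?_).symm
    have := h2.star_star
    rw [star_star] at this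
    exact this.symm
  obtain ⟨y, hy⟩ := star_mem_range_toOp ⟨subOne g, rfl⟩
  rw [← hy, ← toOp_mul, ← toOp_add, ← toOp_add] at hP
  obtain ⟨z, hz⟩ := mul_mem_range_toOp hM ⟨subOne g + y + y * subOne g, rfl⟩
  rw [← hz, sub_eq_iff_eq_add'] at hP
  have hu := isUnit_abs (isUnit_repr g)
  rw [repr_apply, hP] at hu
  obtain ⟨k, hk⟩ := exists_subOne_eq_of_isUnit hu
  exact ⟨k, by rw [repr_apply, repr_apply, hP, hk]⟩

theorem mk_mem_pathComponentOne (g : GLn (L1 τ) n) :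
    GLInf.mk n g ∈ Subgroup.pathComponentOne (GLInf (L1 τ)) := by
  obtain ⟨k, hk⟩ := exists_repr_eq_abs g
  have h1 : repr k⁻¹ * repr k = 1 := by rw [← map_mul, inv_mul_cancel, map_one]
  have h2 : repr k * repr k⁻¹ = 1 := by rw [← map_mul, mul_inv_cancel, map_one]
  have h3 : repr (g * k⁻¹) ∈ unitary
      (HilbertPow H n →L[ℂ] HilbertPow H n) := by
    rw [map_mul]
    rw [hk] at h1 h2
    exact mul_mem_unitary_of_abs (isUnit_repr g) h2 h1
  -- Polar decomposition inside the group: g = (g k⁻¹) k with k acting as |g|.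
  have := mul_mem (mk_mem_of_unitary _ h3) (mk_mem_of_nonneg k (hk ▸ CFC.abs_nonneg (repr g)))
  rwa [← GLInf.mk_mul, inv_mul_cancel_right] at this

end L1

end TraceIdeal

end

theorem mainTheorem1 {H : Type*} [NormedAddCommGroup H] [InnerProductSpace ℂ H] [CompleteSpace H]
    (N : VonNeumannAlgebra H) (τ : TraceIdeal.NFSTrace N) :
    Subsingleton (TopologicalK.K₁ (TraceIdeal.L1 τ)) := by
  rw [QuotientGroup.subsingleton_iff, eq_top_iff]
  intro x _
  obtain ⟨n, g, rfl⟩ := TopologicalK.GLInf.exists_eq_mk x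
  exact TraceIdeal.L1.mk_mem_pathComponentOne g
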